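/- Let $G=(V,E)$ be a finite simple graph with $n\ge 1$ vertices and maximum degree $\Delta$. The decentralized coloring algorithm first gives each vertex a color from $\{1,\dots,\Delta+1\}$, independently and uniformly at random; then, as long as the coloring is not proper, it performs a recoloring step: it chooses a vertex uniformly at random among all vertices that have a neighbor of the same color, and recolors it with a uniformly random color from $\{1,\dots,\Delta+1\}$ (all choices being independent of the past given the current coloring). Let $T\in\{0,1,2,\dots\}\cup\{\infty\}$ be the number of recoloring steps until the coloring is proper. **Proposition.** If $\Delta=\Omega(n^c)$ for some constant $c>0$, then the algorithm terminates within $O(n\log\Delta)$ recoloring steps with high probability. Precisely: for every $c>0$ there is a constant $C>0$ (depending only on $c$) such that for every $a>0$ there is a constant $K>0$ (depending only on $a$ and $c$) such that for every $n \ge 1$ and every graph $G$ on $n$ vertices with maximum degree $\Delta\ge a\,n^c$, $$\Pr\big[\,T> C\,n\log\Delta\,\big]\;\le\; K\,n^{-c}.$$ In particular, this probability tends to $0$ as $n\to\infty$, uniformly over all such graphs. -/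

import Mathlib

namespace DecentralizedColoring

section

variable {V : Type*} [Fintype V] [DecidableEq V] (G : SimpleGraph V) [DecidableRel G.Adj]

/-- A (not necessarily proper) assignment of one of `Δ(G) + 1` colors to every vertex. -/
abbrev Assignment : Type _ := V → Fin (G.maxDegree + 1)

/-- The assignment is a proper coloring of `G`. -/
def IsProper (c : Assignment G) : Prop := ∀ ⦃u v : V⦄, G.Adj u v → c u ≠ c v

/-- The conflicted vertices: those that have a neighbor of the same color. -/
def conflicted (c : Assignment G) : Finset V :=
  Finset.univ.filter fun v => ∃ w, G.Adj v w ∧ c v = c w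

/-- There is no conflicted vertex exactly if the coloring is proper. -/
theorem conflicted_nonempty_iff (c : Assignment G) :
    (conflicted G c).Nonempty ↔ ¬ IsProper G c := by
  simp [Finset.Nonempty, conflicted, IsProper]

/-- The law of the initial assignment: every vertex gets, independently, a uniform color. -/
noncomputable def initialLaw : MeasureTheory.Measure (Assignment G) :=
  MeasureTheory.Measure.pi fun _ : V => (PMF.uniformOfFintype (Fin (G.maxDegree + 1))).toMeasure

/-- One recoloring step: a uniformly random conflicted vertex `v` gets a uniformly random new
color `a`. If there is no conflict, then the algorithm has terminated and nothing changes. -/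
noncomputable def step (c : Assignment G) : PMF (Assignment G) :=
  if h : (conflicted G c).Nonempty then
    (PMF.uniformOfFinset (conflicted G c) h).bind fun v =>
      (PMF.uniformOfFintype (Fin (G.maxDegree + 1))).map fun a => Function.update c v a
  else PMF.pure c

/-- The law of the assignment after `t + 1` steps, given the assignments `c₀, …, c_t`. -/
noncomputable def stepKernel (t : ℕ) :
    ProbabilityTheory.Kernel ((i : Finset.Iic t) → (fun _ : ℕ => Assignment G) i)
      ((fun _ : ℕ => Assignment G) (t + 1)) :=
  ProbabilityTheory.Kernel.ofFunOfCountable fun h =>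
    (step G (h ⟨t, Finset.mem_Iic.2 le_rfl⟩)).toMeasure

instance (t : ℕ) : ProbabilityTheory.IsMarkovKernel (stepKernel G t) :=
  ⟨fun h => PMF.toMeasure.isProbabilityMeasure (step G (h ⟨t, Finset.mem_Iic.2 le_rfl⟩))⟩

/-- The law, on infinite trajectories `(c₀, c₁, …)`, of the decentralized coloring algorithm:
the Markov chain that starts in `initialLaw G` and moves according to `step G`. -/
noncomputable def processLaw : MeasureTheory.Measure (ℕ → Assignment G) :=
  ProbabilityTheory.Kernel.trajMeasure (X := fun _ : ℕ => Assignment G)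
    (initialLaw G) (stepKernel G)

instance : MeasureTheory.IsProbabilityMeasure (initialLaw G) := by
  unfold initialLaw
  infer_instance

instance : MeasureTheory.IsProbabilityMeasure (processLaw G) := by
  unfold processLaw
  infer_instance

/-- The number of recoloring steps until a proper coloring is found (`⊤` if this never happens). -/
noncomputable def runtime (ω : ℕ → Assignment G) : ℕ∞ :=
  ⨅ (t : ℕ) (_ : IsProper G (ω t)), (t : ℕ∞)

end

end DecentralizedColoring

/-!
The runtime bound is a multiplicative drift argument that works from every initial coloring.

Let `n` be the number of vertices, `q = Δ + 1` the number of colors and `S` the set of conflicted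
vertices. The potential of a coloring is
`Φ = #(monochromatic edges) + 7/8 * #S + #(edges between S and its complement) / (8 * q)`.
One recoloring step satisfies `E Φ' ≤ (1 - 1 / (8 * n)) * Φ` (`integral_step_potential_le`). Since
`Φ ≤ 2 * n ^ 2` always and `Φ ≥ 7/8` for improper colorings, Markov's inequality gives
`P[T > t] ≤ 4 * n ^ 2 * exp (-t / (8 * n))` (`measureReal_not_isProper_le`), and with
`t ≈ C * n * log Δ` and `Δ ≥ a * n ^ c` the right-hand side is polynomially small in `n`.

For the drift, suppose that the conflicted vertex `v` gets a random color. It loses its monochromatic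
edges and gains `deg v / q` new ones on average. The neighbors whose only conflict was the one with
`v` become free, and every good neighbor of `v` becomes conflicted with probability `1 / q`. As each
conflicted vertex `u` has `monoDegree u + leafIndicator u ≥ 2`, averaging over `v ∈ S` shows that
edges plus conflicted vertices alone decrease by at least the average over `v ∈ S` of
`1 - (number of good neighbors of v) / q`. This is of order `1 / q` only when conflicted vertices
see almost exclusively good neighbors. The boundary term of `Φ` covers that case: the newly
conflicted vertices are then hit with probability proportional to their number `h` of conflicted
neighbors, so the boundary shrinks by a quantity of order `∑ h ^ 2` over good vertices, which by
Cauchy-Schwarz is at least `(∑ h) ^ 2 / n`. The trade-off between the two effects is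
`drift_inequality`.

Sets of vertices are encoded by their real indicator functions, so that adding and removing
vertices, and summing over the random choices, is linear algebra with the adjacency matrix.
-/

-- Several lemmas do not need every instance among the section variables.
set_option linter.unusedSectionVars false

namespace DecentralizedColoring

section

open MeasureTheory ProbabilityTheory

variable {V : Type*} [Fintype V] [DecidableEq V] (G : SimpleGraph V) [DecidableRel G.Adj]

/-! ### The energy of a vertex set -/

/-- For the indicator function `x` of a vertex set: `7/8` of its size, plus the number of edges
between the set and its complement over `8 * (Δ + 1)`. -/
noncomputable def energy (x : V → ℝ) : ℝ :=
  7 / 8 * ∑ u, x u +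
    (∑ u, ∑ w, G.adjMatrix ℝ u w * (x u * (1 - x w))) / (8 * ((G.maxDegree : ℝ) + 1))

theorem adjMatrix_nonneg (u w : V) : 0 ≤ G.adjMatrix ℝ u w := by
  rw [SimpleGraph.adjMatrix_apply]; split_ifs <;> norm_num

theorem adjMatrix_comm (u w : V) : G.adjMatrix ℝ u w = G.adjMatrix ℝ w u := by
  simp [SimpleGraph.adjMatrix_apply, G.adj_comm]

theorem sum_adjMatrix_le (u : V) : ∑ w, G.adjMatrix ℝ u w ≤ G.maxDegree := by
  have h : ∑ w, G.adjMatrix ℝ u w = G.degree u := by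
    simp [SimpleGraph.adjMatrix_apply, ← G.card_neighborFinset_eq_degree,
      SimpleGraph.neighborFinset_eq_filter]
  rw [h]
  exact_mod_cast G.degree_le_maxDegree u

theorem sum_adjMatrix_symm (f g : V → ℝ) :
    ∑ u, f u * ∑ w, G.adjMatrix ℝ u w * g w = ∑ u, g u * ∑ w, G.adjMatrix ℝ u w * f w := by
  simp only [Finset.mul_sum]
  rw [Finset.sum_comm]
  refine Finset.sum_congr rfl fun u _ => Finset.sum_congr rfl fun w _ => ?_
  rw [adjMatrix_comm]; ring

/-- A new vertex adds `7/8`, and removes at most `Δ` edges from the boundary. Hence an upper bound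
for the set of conflicted vertices is enough to bound its energy. -/
theorem energy_mono {x y : V → ℝ} (hxy : ∀ u, x u ≤ y u)
    (hy : ∀ u, y u ≤ 1) : energy G x ≤ energy G y := by
  have hq : (0 : ℝ) < 8 * ((G.maxDegree : ℝ) + 1) := by positivity
  have h1 : ∑ u, ∑ w, G.adjMatrix ℝ u w * (x u * (1 - x w)) ≤
      ∑ u, ∑ w, G.adjMatrix ℝ u w * (y u * (1 - y w)) +
        ∑ u, (y u - x u) * ∑ w, G.adjMatrix ℝ u w * 1 := by
    rw [sum_adjMatrix_symm, ← Finset.sum_add_distrib]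
    refine Finset.sum_le_sum fun u _ => ?_
    rw [one_mul, ← Finset.sum_add_distrib]
    refine Finset.sum_le_sum fun w _ => ?_
    rw [← mul_add]
    refine mul_le_mul_of_nonneg_left ?_ (adjMatrix_nonneg G u w)
    nlinarith [hxy w,
      mul_nonneg (sub_nonneg.2 (hxy u)) (sub_nonneg.2 (hy w)),
      mul_nonneg (sub_nonneg.2 (hxy w)) (sub_nonneg.2 ((hxy u).trans (hy u)))]
  have h2 : ∑ u, (y u - x u) * ∑ w, G.adjMatrix ℝ u w * 1 ≤
      ∑ u, (y u - x u) * ((G.maxDegree : ℝ) + 1) := by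
    refine Finset.sum_le_sum fun u _ => mul_le_mul_of_nonneg_left ?_ (sub_nonneg.2 (hxy u))
    simp only [mul_one]
    linarith [sum_adjMatrix_le G u]
  rw [← Finset.sum_mul, Finset.sum_sub_distrib] at h2
  have h3 : ∑ u, x u ≤ ∑ u, y u := Finset.sum_le_sum fun u _ => hxy u
  unfold energy
  have h4 := div_le_div_of_nonneg_right (h1.trans (add_le_add_right h2 _)) hq.le
  rw [add_div, mul_div_assoc, show ((G.maxDegree : ℝ) + 1) / (8 * ((G.maxDegree : ℝ) + 1)) = 1 / 8
    by field_simp] at h4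
  linarith

/-- First-order expansion of the energy when `ρ` is removed from `x` and `α` is added; the
quadratic terms `ρ, ρ` and `α, α` only help. -/
theorem energy_sub_add_le (x ρ α : V → ℝ) (hρ : ∀ u, 0 ≤ ρ u) (hα : ∀ u, 0 ≤ α u) :
    energy G (fun u => x u - ρ u + α u) ≤ energy G x +
      ∑ u, (α u - ρ u) * (7 / 8 + ((∑ w, G.adjMatrix ℝ u w) -
        2 * ∑ w, G.adjMatrix ℝ u w * x w) / (8 * ((G.maxDegree : ℝ) + 1))) +
      (∑ u, ρ u * ∑ w, G.adjMatrix ℝ u w * α w) / (4 * ((G.maxDegree : ℝ) + 1)) := by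
  set q : ℝ := (G.maxDegree : ℝ) + 1 with hq
  have hq0 : 0 < q := by positivity
  have e1 : ∑ u, ∑ w, G.adjMatrix ℝ u w * ((x u - ρ u + α u) * (1 - (x w - ρ w + α w))) ≤
      ∑ u, ∑ w, G.adjMatrix ℝ u w * (x u * (1 - x w)) +
      ∑ u, (α u - ρ u) * ((∑ w, G.adjMatrix ℝ u w) - ∑ w, G.adjMatrix ℝ u w * x w) -
      ∑ u, x u * ∑ w, G.adjMatrix ℝ u w * (α w - ρ w) +
      ∑ u, α u * ∑ w, G.adjMatrix ℝ u w * ρ w + ∑ u, ρ u * ∑ w, G.adjMatrix ℝ u w * α w := by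
    rw [← Finset.sum_add_distrib, ← Finset.sum_sub_distrib, ← Finset.sum_add_distrib,
      ← Finset.sum_add_distrib]
    refine Finset.sum_le_sum fun u _ => ?_
    rw [← Finset.sum_sub_distrib, Finset.mul_sum, Finset.mul_sum, Finset.mul_sum, Finset.mul_sum,
      ← Finset.sum_add_distrib, ← Finset.sum_sub_distrib, ← Finset.sum_add_distrib,
      ← Finset.sum_add_distrib]
    refine Finset.sum_le_sum fun w _ => ?_
    have hA := adjMatrix_nonneg G u w
    nlinarith [mul_nonneg hA (mul_nonneg (hρ u) (hρ w)), mul_nonneg hA (mul_nonneg (hα u) (hα w))]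
  rw [sum_adjMatrix_symm G x, sum_adjMatrix_symm G α] at e1
  have e2 : ∑ u, (α u - ρ u) * (7 / 8 + ((∑ w, G.adjMatrix ℝ u w) -
        2 * ∑ w, G.adjMatrix ℝ u w * x w) / (8 * q)) =
      7 / 8 * (∑ u, α u - ∑ u, ρ u) +
      (∑ u, (α u - ρ u) * ((∑ w, G.adjMatrix ℝ u w) - ∑ w, G.adjMatrix ℝ u w * x w) -
        ∑ u, (α u - ρ u) * ∑ w, G.adjMatrix ℝ u w * x w) / (8 * q) := by
    rw [← Finset.sum_sub_distrib, ← Finset.sum_sub_distrib, Finset.mul_sum, Finset.sum_div,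
      ← Finset.sum_add_distrib]
    refine Finset.sum_congr rfl fun u _ => ?_
    ring
  rw [e2]
  unfold energy
  rw [← hq, Finset.sum_add_distrib, Finset.sum_sub_distrib]
  have e3 := div_le_div_of_nonneg_right e1 (by positivity : (0 : ℝ) ≤ 8 * q)
  have e4 : (∑ u, ρ u * ∑ w, G.adjMatrix ℝ u w * α w) / (4 * q) =
      2 * ((∑ u, ρ u * ∑ w, G.adjMatrix ℝ u w * α w) / (8 * q)) := by
    generalize (∑ u, ρ u * ∑ w, G.adjMatrix ℝ u w * α w) = z
    field_simp; ring
  rw [e4]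
  simp only [add_div, sub_div] at e3 ⊢
  linarith

/-! ### Conflicts as indicator functions, and the potential -/

/-- `1` on conflicted vertices, `0` elsewhere. -/
noncomputable def conflictIndicator (c : Assignment G) (u : V) : ℝ :=
  if u ∈ conflicted G c then 1 else 0

/-- `1` on (ordered) monochromatic edges, `0` elsewhere. -/
noncomputable def monoIndicator (c : Assignment G) (u w : V) : ℝ :=
  if G.Adj u w ∧ c u = c w then 1 else 0

/-- The number of neighbors of `u` that have the color of `u`. -/
noncomputable def monoDegree (c : Assignment G) (u : V) : ℝ := ∑ w, monoIndicator G c u w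

/-- `1` on the vertices with exactly one neighbor of their own color, `0` elsewhere. -/
noncomputable def leafIndicator (c : Assignment G) (u : V) : ℝ :=
  if monoDegree G c u = 1 then 1 else 0

/-- The potential: monochromatic edges, plus the energy of the set of conflicted vertices. -/
noncomputable def potential (c : Assignment G) : ℝ :=
  (∑ u, monoDegree G c u) / 2 + energy G (conflictIndicator G c)

theorem conflictIndicator_mem (c : Assignment G) (u : V) :
    conflictIndicator G c u = 0 ∨ conflictIndicator G c u = 1 := by
  unfold conflictIndicator; split_ifs <;> simp

theorem monoIndicator_nonneg (c : Assignment G) (u w : V) : 0 ≤ monoIndicator G c u w := by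
  unfold monoIndicator; split_ifs <;> norm_num

theorem monoDegree_nonneg (c : Assignment G) (u : V) : 0 ≤ monoDegree G c u :=
  Finset.sum_nonneg fun w _ => monoIndicator_nonneg G c u w

theorem monoDegree_eq_card (c : Assignment G) (u : V) :
    monoDegree G c u = (Finset.univ.filter fun w => G.Adj u w ∧ c u = c w).card := by
  simp [monoDegree, monoIndicator]

theorem mem_conflicted_iff (c : Assignment G) (u : V) :
    u ∈ conflicted G c ↔ ∃ w, G.Adj u w ∧ c u = c w := by
  simp [conflicted]

theorem monoDegree_eq_zero_of_notMem {c : Assignment G} {u : V} (h : u ∉ conflicted G c) :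
    monoDegree G c u = 0 := by
  rw [mem_conflicted_iff] at h
  refine Finset.sum_eq_zero fun w _ => ?_
  exact if_neg fun hw => h ⟨w, hw⟩

theorem leafIndicator_nonneg (c : Assignment G) (u : V) : 0 ≤ leafIndicator G c u := by
  unfold leafIndicator; split_ifs <;> norm_num

theorem leafIndicator_le (c : Assignment G) (u : V) :
    leafIndicator G c u ≤ conflictIndicator G c u := by
  unfold leafIndicator conflictIndicator
  by_cases h : u ∈ conflicted G c
  · rw [if_pos h]; split_ifs <;> norm_num
  · rw [monoDegree_eq_zero_of_notMem G h, if_neg h]; norm_num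

/-- A conflicted vertex either has two neighbors of its own color, or is a leaf. -/
theorem two_mul_conflictIndicator_le (c : Assignment G) (u : V) :
    2 * conflictIndicator G c u ≤ monoDegree G c u + leafIndicator G c u := by
  unfold leafIndicator conflictIndicator
  rw [monoDegree_eq_card]
  split_ifs with h h1 h1
  · rw [h1]; norm_num
  · have h0 : 0 < (Finset.univ.filter fun w => G.Adj u w ∧ c u = c w).card := by
      rw [mem_conflicted_iff] at h
      obtain ⟨w, hw⟩ := h
      exact Finset.card_pos.2 ⟨w, by simpa using hw⟩
    have h2 : (Finset.univ.filter fun w => G.Adj u w ∧ c u = c w).card ≠ 1 := by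
      exact_mod_cast h1
    have h3 : 2 ≤ (Finset.univ.filter fun w => G.Adj u w ∧ c u = c w).card := by omega
    have : (2 : ℝ) ≤ (Finset.univ.filter fun w => G.Adj u w ∧ c u = c w).card := by
      exact_mod_cast h3
    linarith
  · linarith [(Nat.cast_nonneg _ : (0 : ℝ) ≤
      ((Finset.univ.filter fun w => G.Adj u w ∧ c u = c w).card : ℝ))]
  · simp

/-! ### The effect of recoloring one vertex -/

/-- The conflicted vertices that recoloring `v` by `b` is sure to set free: the neighbors of `v`
whose only conflict is the one with `v`. -/
noncomputable def freed (c : Assignment G) (v : V) (b : Fin (G.maxDegree + 1)) (u : V) : ℝ :=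
  if b ≠ c v then monoIndicator G c v u * leafIndicator G c u else 0

/-- The vertices that recoloring `v` by `b` brings into conflict: the neighbors of `v` of color `b`
that had no conflict. -/
noncomputable def infected (c : Assignment G) (v : V) (b : Fin (G.maxDegree + 1)) (u : V) : ℝ :=
  if c u = b then G.adjMatrix ℝ v u * (1 - conflictIndicator G c u) else 0

theorem freed_nonneg (c : Assignment G) (v : V) (b : Fin (G.maxDegree + 1)) (u : V) :
    0 ≤ freed G c v b u := by
  unfold freed
  split_ifs
  · exact mul_nonneg (monoIndicator_nonneg ..) (leafIndicator_nonneg ..)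
  · rfl

theorem infected_nonneg (c : Assignment G) (v : V) (b : Fin (G.maxDegree + 1)) (u : V) :
    0 ≤ infected G c v b u := by
  unfold infected
  split_ifs
  · refine mul_nonneg (adjMatrix_nonneg ..) ?_
    rcases conflictIndicator_mem G c u with h | h <;> rw [h] <;> norm_num
  · rfl

theorem infected_le (c : Assignment G) (v : V) (b : Fin (G.maxDegree + 1)) (u : V) :
    infected G c v b u ≤ 1 - conflictIndicator G c u := by
  unfold infected conflictIndicator
  rw [SimpleGraph.adjMatrix_apply]
  split_ifs <;> norm_num

/-- Only an upper bound: `v` itself is kept on the right-hand side even if its new color is free. -/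
theorem conflictIndicator_update_le (c : Assignment G) {v : V} (hv : v ∈ conflicted G c)
    (b : Fin (G.maxDegree + 1)) (u : V) :
    conflictIndicator G (Function.update c v b) u ≤
      conflictIndicator G c u - freed G c v b u + infected G c v b u := by
  have hi := infected_nonneg G c v b u
  have hf : freed G c v b u ≤ conflictIndicator G c u := by
    refine le_trans ?_ (leafIndicator_le G c u)
    have := leafIndicator_nonneg G c u
    unfold freed monoIndicator
    split_ifs <;> linarith
  by_cases hu : u ∈ conflicted G (Function.update c v b)
  swap
  · rw [conflictIndicator, if_neg hu]; linarith
  rw [conflictIndicator, if_pos hu]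
  by_cases hb : b = c v
  · subst hb
    rw [Function.update_eq_self] at hu
    simp only [freed, ne_eq, not_true_eq_false, if_false, conflictIndicator, if_pos hu]
    linarith
  by_cases huv : u = v
  · subst huv
    simp only [freed, monoIndicator, G.irrefl, false_and, if_false, zero_mul, ite_self,
      conflictIndicator, if_pos hv]
    linarith
  rw [mem_conflicted_iff] at hu
  obtain ⟨w, huw, hc⟩ := hu
  rw [Function.update_of_ne huv] at hc
  by_cases hwv : w = v
  · subst hwv
    rw [Function.update_self] at hc
    have h0 : freed G c w b u = 0 := by
      have : ¬ (c w = c u) := fun h => hb (hc ▸ h.symm)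
      simp [freed, monoIndicator, this]
    rw [h0]
    by_cases hu : u ∈ conflicted G c
    · simp only [conflictIndicator, if_pos hu]; linarith
    · simp [conflictIndicator, hu, infected, hc, huw.symm]
  · rw [Function.update_of_ne hwv] at hc
    have hu : u ∈ conflicted G c := (mem_conflicted_iff G c u).2 ⟨w, huw, hc⟩
    have h0 : freed G c v b u = 0 := by
      rw [freed, if_pos hb, monoIndicator]
      split_ifs with h
      · rw [one_mul, leafIndicator, if_neg]
        rw [monoDegree_eq_card]
        have : 1 < (Finset.univ.filter fun w => G.Adj u w ∧ c u = c w).card :=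
          Finset.one_lt_card.2 ⟨w, by simpa using ⟨huw, hc⟩, v,
            by simpa using ⟨h.1.symm, h.2.symm⟩, hwv⟩
        exact_mod_cast this.ne'
      · simp
    rw [h0, conflictIndicator, if_pos hu]
    linarith

theorem sum_monoDegree_update (c : Assignment G) (v : V) (b : Fin (G.maxDegree + 1)) :
    ∑ u, monoDegree G (Function.update c v b) u = ∑ u, monoDegree G c u - 2 * monoDegree G c v +
      2 * ∑ w, if c w = b then G.adjMatrix ℝ v w else 0 := by
  -- Only the row and the column of `v` change, and the diagonal entry of `v` is zero.
  have h : ∀ u w, monoIndicator G (Function.update c v b) u w - monoIndicator G c u w =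
      (if u = v then (if c w = b then G.adjMatrix ℝ v w else 0) - monoIndicator G c v w else 0) +
      (if w = v then (if c u = b then G.adjMatrix ℝ v u else 0) - monoIndicator G c v u else 0) := by
    intro u w
    by_cases hu : u = v
    · subst hu
      by_cases hw : w = u
      · subst hw; simp [monoIndicator]
      · simp [monoIndicator, hw, SimpleGraph.adjMatrix_apply,
          eq_comm (a := b), ← ite_and, and_comm]
    · by_cases hw : w = v
      · subst hw
        simp [monoIndicator, hu, SimpleGraph.adjMatrix_apply,
          ← ite_and, and_comm, G.adj_comm, eq_comm (a := c u) (b := c w)]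
      · simp [monoIndicator, hu, hw]
  have h2 := Finset.sum_congr (rfl : (Finset.univ : Finset V) = Finset.univ)
    fun u _ => Finset.sum_congr (rfl : (Finset.univ : Finset V) = Finset.univ) fun w _ => h u w
  simp only [Finset.sum_add_distrib, Finset.sum_sub_distrib, Finset.sum_ite_eq', Finset.mem_univ,
    if_true] at h2
  rw [Finset.sum_comm (f := fun u w => if u = v then _ else _)] at h2
  simp only [Finset.sum_ite_eq', Finset.mem_univ, if_true, Finset.sum_sub_distrib] at h2
  have hm : ∀ c v, ∑ w, monoIndicator G c v w = monoDegree G c v := fun _ _ => rfl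
  simp only [hm] at h2
  linarith

/-! ### Averaging over the recolored vertex and its new color -/

theorem monoIndicator_comm (c : Assignment G) (u w : V) :
    monoIndicator G c u w = monoIndicator G c w u := by
  simp [monoIndicator, G.adj_comm, eq_comm (a := c u)]

theorem conflictIndicator_mul_monoIndicator (c : Assignment G) (v u : V) :
    conflictIndicator G c v * monoIndicator G c v u = monoIndicator G c v u := by
  unfold conflictIndicator monoIndicator
  by_cases h : G.Adj v u ∧ c v = c u
  · rw [if_pos ((mem_conflicted_iff G c v).2 ⟨u, h⟩), one_mul]
  · rw [if_neg h, mul_zero]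

theorem sum_conflictIndicator (c : Assignment G) :
    ∑ u, conflictIndicator G c u = (conflicted G c).card := by
  simp [conflictIndicator]

theorem sum_conflicted (c : Assignment G) (f : V → ℝ) :
    ∑ v ∈ conflicted G c, f v = ∑ v, conflictIndicator G c v * f v := by
  simp [conflictIndicator]

theorem sum_infected (c : Assignment G) (v u : V) :
    ∑ b, infected G c v b u = G.adjMatrix ℝ v u * (1 - conflictIndicator G c u) := by
  simp only [infected, Finset.sum_ite_eq, Finset.mem_univ, if_true]

theorem sum_freed (c : Assignment G) (v u : V) :
    ∑ b, freed G c v b u =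
      (G.maxDegree : ℝ) * (monoIndicator G c v u * leafIndicator G c u) := by
  simp only [freed, ne_eq, Finset.sum_ite, Finset.sum_const_zero, add_zero, Finset.sum_const,
    nsmul_eq_mul]
  congr 2
  rw [Finset.filter_not, Finset.card_sdiff]
  simp [Finset.filter_eq']

/-- Edges between freed and infected vertices stay in the boundary, while the first-order expansion
counts them as lost at both ends. All colors together infect each vertex at most once, so a freed
vertex has at most `Δ` such edges in total. -/
theorem sum_freed_mul_sum_infected_le (c : Assignment G) (v : V) :
    ∑ b, ∑ u, freed G c v b u * ∑ w, G.adjMatrix ℝ u w * infected G c v b w ≤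
      ((G.maxDegree : ℝ) + 1) * ∑ u, monoIndicator G c v u * leafIndicator G c u := by
  have hz : ∀ u, 0 ≤ monoIndicator G c v u * leafIndicator G c u := fun u =>
    mul_nonneg (monoIndicator_nonneg ..) (leafIndicator_nonneg ..)
  calc _ ≤ ∑ b, ∑ u, (monoIndicator G c v u * leafIndicator G c u) *
          ∑ w, G.adjMatrix ℝ u w * infected G c v b w := by
        refine Finset.sum_le_sum fun b _ => Finset.sum_le_sum fun u _ =>
          mul_le_mul_of_nonneg_right ?_ (Finset.sum_nonneg fun w _ =>
            mul_nonneg (adjMatrix_nonneg ..) (infected_nonneg ..))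
        unfold freed
        split_ifs
        · rfl
        · exact hz u
    _ = ∑ u, (monoIndicator G c v u * leafIndicator G c u) *
          ∑ w, G.adjMatrix ℝ u w * ∑ b, infected G c v b w := by
        rw [Finset.sum_comm]
        refine Finset.sum_congr rfl fun u _ => ?_
        rw [← Finset.mul_sum, Finset.sum_comm]
        simp only [Finset.mul_sum]
    _ ≤ ∑ u, (monoIndicator G c v u * leafIndicator G c u) * ((G.maxDegree : ℝ) + 1) := by
        refine Finset.sum_le_sum fun u _ => mul_le_mul_of_nonneg_left ?_ (hz u)
        refine le_trans (Finset.sum_le_sum fun w _ => ?_)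
          ((sum_adjMatrix_le G u).trans (le_add_of_nonneg_right zero_le_one))
        refine mul_le_of_le_one_right (adjMatrix_nonneg ..) ?_
        rw [sum_infected]
        have h1 : 0 ≤ conflictIndicator G c w ∧ conflictIndicator G c w ≤ 1 := by
          rcases conflictIndicator_mem G c w with h | h <;> rw [h] <;> norm_num
        rw [SimpleGraph.adjMatrix_apply]
        split_ifs <;> linarith [h1.1, h1.2]
    _ = _ := by rw [← Finset.sum_mul, mul_comm]

/-- The first-order change of the energy of the conflicted set when the vertex `u` is added to it
(or, with the opposite sign, removed from it). -/
noncomputable def marginal (c : Assignment G) (u : V) : ℝ :=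
  7 / 8 + ((∑ w, G.adjMatrix ℝ u w) - 2 * ∑ w, G.adjMatrix ℝ u w * conflictIndicator G c w) /
    (8 * ((G.maxDegree : ℝ) + 1))

theorem potential_update_le (c : Assignment G) {v : V} (hv : v ∈ conflicted G c)
    (b : Fin (G.maxDegree + 1)) :
    potential G (Function.update c v b) ≤ potential G c - monoDegree G c v +
      (∑ w, if c w = b then G.adjMatrix ℝ v w else 0) +
      ∑ u, (infected G c v b u - freed G c v b u) * marginal G c u +
      (∑ u, freed G c v b u * ∑ w, G.adjMatrix ℝ u w * infected G c v b w) /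
        (4 * ((G.maxDegree : ℝ) + 1)) := by
  have h1 := energy_mono G (conflictIndicator_update_le G c hv b) fun u => by
    linarith [freed_nonneg G c v b u, infected_le G c v b u]
  have h2 := energy_sub_add_le G (conflictIndicator G c) _ _ (freed_nonneg G c v b)
    (infected_nonneg G c v b)
  unfold potential
  rw [sum_monoDegree_update]
  unfold marginal
  linarith

theorem sum_potential_update_le (c : Assignment G) {v : V} (hv : v ∈ conflicted G c) :
    ∑ b, potential G (Function.update c v b) ≤
      ((G.maxDegree : ℝ) + 1) * (potential G c - monoDegree G c v) + ∑ w, G.adjMatrix ℝ v w +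
      ∑ u, (G.adjMatrix ℝ v u * (1 - conflictIndicator G c u) -
        (G.maxDegree : ℝ) * (monoIndicator G c v u * leafIndicator G c u)) * marginal G c u +
      (∑ u, monoIndicator G c v u * leafIndicator G c u) / 4 := by
  refine (Finset.sum_le_sum fun b _ => potential_update_le G c hv b).trans ?_
  simp only [Finset.sum_add_distrib, Finset.sum_const, Finset.card_univ, Fintype.card_fin,
    nsmul_eq_mul, Nat.cast_add, Nat.cast_one]
  have h1 : ∑ b, ∑ w, (if c w = b then G.adjMatrix ℝ v w else 0) = ∑ w, G.adjMatrix ℝ v w := by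
    rw [Finset.sum_comm]
    simp only [Finset.sum_ite_eq, Finset.mem_univ, if_true]
  have h2 : ∑ b, ∑ u, (infected G c v b u - freed G c v b u) * marginal G c u =
      ∑ u, (G.adjMatrix ℝ v u * (1 - conflictIndicator G c u) -
        (G.maxDegree : ℝ) * (monoIndicator G c v u * leafIndicator G c u)) * marginal G c u := by
    rw [Finset.sum_comm]
    refine Finset.sum_congr rfl fun u _ => ?_
    rw [← Finset.sum_mul, Finset.sum_sub_distrib, sum_infected, sum_freed]
  have h3 := div_le_div_of_nonneg_right (sum_freed_mul_sum_infected_le G c v)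
    (by positivity : (0 : ℝ) ≤ 4 * ((G.maxDegree : ℝ) + 1))
  rw [← Finset.sum_div, h1, h2]
  have h4 : ((G.maxDegree : ℝ) + 1) * (∑ u, monoIndicator G c v u * leafIndicator G c u) /
      (4 * ((G.maxDegree : ℝ) + 1)) = (∑ u, monoIndicator G c v u * leafIndicator G c u) / 4 := by
    generalize (∑ u, monoIndicator G c v u * leafIndicator G c u) = z
    field_simp
  rw [h4] at h3
  linarith

/-- Every leaf is freed by exactly one vertex `v`. -/
theorem sum_monoIndicator_mul_leafIndicator (c : Assignment G) (u : V) :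
    ∑ v, monoIndicator G c v u * leafIndicator G c u = leafIndicator G c u := by
  rw [← Finset.sum_mul]
  simp only [monoIndicator_comm G c _ u]
  change monoDegree G c u * _ = _
  unfold leafIndicator
  split_ifs with h
  · rw [h, one_mul]
  · rw [mul_zero]

theorem sum_conflicted_sum_potential_update_le (c : Assignment G) :
    ∑ v ∈ conflicted G c, ∑ b, potential G (Function.update c v b) ≤
      ((G.maxDegree : ℝ) + 1) *
        ((conflicted G c).card * potential G c - ∑ u, monoDegree G c u) +
      ∑ u, conflictIndicator G c u * ∑ w, G.adjMatrix ℝ u w +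
      ∑ u, ((∑ w, G.adjMatrix ℝ u w * conflictIndicator G c w) * (1 - conflictIndicator G c u) -
        (G.maxDegree : ℝ) * leafIndicator G c u) * marginal G c u +
      (∑ u, leafIndicator G c u) / 4 := by
  refine (Finset.sum_le_sum fun v hv => sum_potential_update_le G c hv).trans ?_
  rw [Finset.sum_add_distrib, Finset.sum_add_distrib, Finset.sum_add_distrib]
  have hx : ∀ v, conflictIndicator G c v * monoDegree G c v = monoDegree G c v := fun v => by
    simp only [monoDegree, Finset.mul_sum, conflictIndicator_mul_monoIndicator]
  have h1 : ∑ v ∈ conflicted G c, ((G.maxDegree : ℝ) + 1) * (potential G c - monoDegree G c v) =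
      ((G.maxDegree : ℝ) + 1) *
        ((conflicted G c).card * potential G c - ∑ u, monoDegree G c u) := by
    rw [← Finset.mul_sum, Finset.sum_sub_distrib, sum_conflicted G c (monoDegree G c)]
    simp only [hx, Finset.sum_const, nsmul_eq_mul]
  have h2 : ∑ v ∈ conflicted G c, ∑ u, (G.adjMatrix ℝ v u * (1 - conflictIndicator G c u) -
        (G.maxDegree : ℝ) * (monoIndicator G c v u * leafIndicator G c u)) * marginal G c u =
      ∑ u, ((∑ w, G.adjMatrix ℝ u w * conflictIndicator G c w) * (1 - conflictIndicator G c u) -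
        (G.maxDegree : ℝ) * leafIndicator G c u) * marginal G c u := by
    rw [Finset.sum_comm]
    refine Finset.sum_congr rfl fun u _ => ?_
    rw [← Finset.sum_mul, sum_conflicted]
    congr 1
    have hl : (G.maxDegree : ℝ) * leafIndicator G c u =
        ∑ v, (G.maxDegree : ℝ) * (monoIndicator G c v u * leafIndicator G c u) := by
      rw [← Finset.mul_sum, sum_monoIndicator_mul_leafIndicator]
    rw [hl, Finset.sum_mul, ← Finset.sum_sub_distrib]
    refine Finset.sum_congr rfl fun v _ => ?_
    rw [← conflictIndicator_mul_monoIndicator G c v u, adjMatrix_comm G v u]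
    rcases conflictIndicator_mem G c v with h | h <;> rw [h] <;> ring
  have h3 : ∑ v ∈ conflicted G c, (∑ u, monoIndicator G c v u * leafIndicator G c u) / 4 =
      (∑ u, leafIndicator G c u) / 4 := by
    rw [← Finset.sum_div, sum_conflicted]
    simp only [Finset.mul_sum, ← mul_assoc, conflictIndicator_mul_monoIndicator]
    rw [Finset.sum_comm]
    simp only [sum_monoIndicator_mul_leafIndicator]
  rw [h1, h2, h3, sum_conflicted]

/-- The arithmetic of the drift. The variables stand for: `n` vertices, `q` colors, `N` conflicted
vertices, `D` and `H` the sums over them of the degree and of the number of conflicted neighbors,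
`L` leaves, `M` the sum of the monochromatic degrees, `Q` the sum over the good vertices of the
squared number of conflicted neighbors. -/
theorem drift_inequality {n q N D H L M Q : ℝ} (hq : 1 ≤ q) (hN : 0 ≤ N) (hNn : N ≤ n)
    (hn : 0 < n) (hD : D ≤ (q - 1) * N) (hH : 0 ≤ H) (hLN : L ≤ N) (hL : 0 ≤ L)
    (hy : 2 * N ≤ M + L) (hQ : (D - H) ^ 2 ≤ n * Q) :
    -(q * M) + D + (D - H) - Q / (4 * q) - (q - 1) * L + (q * N - D) / 8 + H / 4 + L / 4 ≤
      -(q * N * (M / 2 + N)) / (8 * n) := by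
  have hq0 : 0 < q := by linarith
  -- `F` is the sum over conflicted vertices of `1 - (number of good neighbors) / q`. The linear
  -- terms give `5/8 * F`, and the term `Q` gives `(N - F) ^ 2 / (4 * n)`.
  set F : ℝ := (q * N - D + H) / q with hF
  have hqF : q * F = q * N - D + H := by rw [hF]; field_simp
  have hF0 : 0 ≤ F := div_nonneg (by nlinarith) hq0.le
  have hΓ : D - H = q * (N - F) := by linarith
  have h1 : q * (N - F) ^ 2 / (4 * n) ≤ Q / (4 * q) := by
    rw [div_le_div_iff₀ (by positivity) (by positivity)]
    rw [hΓ] at hQ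
    nlinarith
  have h2 : N * (M / 2 + N) / (8 * n) ≤ (M + L - 2 * N) + 5 / 8 * F + (N - F) ^ 2 / (4 * n) := by
    have hy0 : 0 ≤ M + L - 2 * N := by linarith
    have e : (N - F) ^ 2 / (4 * n) = 2 * (N - F) ^ 2 / (8 * n) := by field_simp; ring
    rw [e, ← sub_le_iff_le_add, ← sub_div, div_le_iff₀ (by positivity)]
    have a1 : N * (M + L - 2 * N) ≤ n * (M + L - 2 * N) := mul_le_mul_of_nonneg_right hNn hy0
    have a2 : N * F ≤ n * F := mul_le_mul_of_nonneg_right hNn hF0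
    nlinarith [mul_nonneg hN hy0, mul_nonneg hN hL, mul_nonneg hN hF0]
  have h3 := mul_le_mul_of_nonneg_left h2 hq0.le
  have e3 : -(q * N * (M / 2 + N)) / (8 * n) = -(q * (N * (M / 2 + N) / (8 * n))) := by ring
  have e4 : q * ((M + L - 2 * N) + 5 / 8 * F + (N - F) ^ 2 / (4 * n)) =
      q * (M + L - 2 * N) + 5 / 8 * (q * F) + q * (N - F) ^ 2 / (4 * n) := by ring
  rw [e3]
  rw [e4] at h3
  nlinarith

/-! ### The drift of the potential -/

theorem conflictIndicator_nonneg (c : Assignment G) (u : V) : 0 ≤ conflictIndicator G c u := by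
  rcases conflictIndicator_mem G c u with h | h <;> rw [h]; norm_num

theorem conflictIndicator_le_one (c : Assignment G) (u : V) : conflictIndicator G c u ≤ 1 := by
  rcases conflictIndicator_mem G c u with h | h <;> rw [h]; norm_num

theorem boundary_nonneg (c : Assignment G) : 0 ≤ ∑ u, ∑ w, G.adjMatrix ℝ u w *
    (conflictIndicator G c u * (1 - conflictIndicator G c w)) :=
  Finset.sum_nonneg fun _ _ => Finset.sum_nonneg fun _ _ => mul_nonneg (adjMatrix_nonneg ..)
    (mul_nonneg (conflictIndicator_nonneg ..) (sub_nonneg.2 (conflictIndicator_le_one ..)))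

theorem card_le_potential (c : Assignment G) :
    7 / 8 * ((conflicted G c).card : ℝ) ≤ potential G c := by
  unfold potential energy
  rw [sum_conflictIndicator]
  have h1 : 0 ≤ ∑ u, monoDegree G c u := Finset.sum_nonneg fun u _ => monoDegree_nonneg G c u
  have h2 := div_nonneg (boundary_nonneg G c)
    (by positivity : 0 ≤ 8 * ((G.maxDegree : ℝ) + 1))
  linarith

theorem potential_le (c : Assignment G) :
    potential G c ≤ (∑ u, monoDegree G c u) / 2 + (conflicted G c).card := by
  have h : ∑ u, ∑ w, G.adjMatrix ℝ u w *
      (conflictIndicator G c u * (1 - conflictIndicator G c w)) ≤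
        (conflicted G c).card * ((G.maxDegree : ℝ) + 1) := by
    rw [← sum_conflictIndicator, Finset.sum_mul]
    refine Finset.sum_le_sum fun u _ => ?_
    calc _ ≤ ∑ w, conflictIndicator G c u * G.adjMatrix ℝ u w :=
          Finset.sum_le_sum fun w _ => by
            nlinarith [mul_nonneg (adjMatrix_nonneg G u w)
              (mul_nonneg (conflictIndicator_nonneg G c u) (conflictIndicator_nonneg G c w))]
      _ ≤ _ := by
          rw [← Finset.mul_sum]
          refine mul_le_mul_of_nonneg_left ?_ (conflictIndicator_nonneg ..)
          linarith [sum_adjMatrix_le G u]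
  unfold potential energy
  rw [sum_conflictIndicator]
  have h2 := div_le_div_of_nonneg_right h (by positivity : 0 ≤ 8 * ((G.maxDegree : ℝ) + 1))
  have h3 : (conflicted G c).card * ((G.maxDegree : ℝ) + 1) / (8 * ((G.maxDegree : ℝ) + 1)) =
      (conflicted G c).card / 8 := by field_simp
  linarith

theorem potential_le_sq (c : Assignment G) : potential G c ≤ 2 * (Fintype.card V : ℝ) ^ 2 := by
  refine (potential_le G c).trans ?_
  have h1 : ∀ u, monoDegree G c u ≤ Fintype.card V := fun u => by
    rw [monoDegree_eq_card]; exact_mod_cast Finset.card_le_univ _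
  have h2 : ∑ u, monoDegree G c u ≤ Fintype.card V * Fintype.card V :=
    (Finset.sum_le_sum fun u _ => h1 u).trans (by simp)
  have h3 : ((conflicted G c).card : ℝ) ≤ Fintype.card V := by
    exact_mod_cast Finset.card_le_univ _
  have h4 : (Fintype.card V : ℝ) ≤ Fintype.card V * Fintype.card V := by
    exact_mod_cast Nat.le_mul_self _
  nlinarith

/-- The multiplicative drift, as a sum over the equally likely pairs of a conflicted vertex and a
new color. -/
theorem potential_drift [Nonempty V] (c : Assignment G) :
    ∑ v ∈ conflicted G c, ∑ b, potential G (Function.update c v b) ≤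
      ((G.maxDegree : ℝ) + 1) * (conflicted G c).card *
        ((1 - 1 / (8 * Fintype.card V)) * potential G c) := by
  refine (sum_conflicted_sum_potential_update_le G c).trans ?_
  set x := conflictIndicator G c with hx
  set l := leafIndicator G c with hl
  set q : ℝ := (G.maxDegree : ℝ) + 1 with hq
  set N : ℝ := ((conflicted G c).card : ℝ) with hN
  set n : ℝ := (Fintype.card V : ℝ) with hn
  set d : V → ℝ := fun u => ∑ w, G.adjMatrix ℝ u w with hd
  set h : V → ℝ := fun u => ∑ w, G.adjMatrix ℝ u w * x w with hh
  have hx0 : ∀ u, 0 ≤ x u := conflictIndicator_nonneg G c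
  have hx1 : ∀ u, x u ≤ 1 := conflictIndicator_le_one G c
  have hh0 : ∀ u, 0 ≤ h u := fun u => Finset.sum_nonneg fun w _ =>
    mul_nonneg (adjMatrix_nonneg ..) (hx0 w)
  have hdq : ∀ u, d u ≤ q - 1 := fun u => by
    rw [hq, add_sub_cancel_right]; exact sum_adjMatrix_le G u
  have hl0 : ∀ u, 0 ≤ l u := leafIndicator_nonneg G c
  have hlx : ∀ u, l u ≤ x u := leafIndicator_le G c
  have hq1 : 1 ≤ q := by rw [hq]; linarith [Nat.cast_nonneg (α := ℝ) G.maxDegree]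
  have hq0 : 0 < q := by linarith
  have hsx : ∑ u, x u = N := sum_conflictIndicator G c
  have hn0 : 0 < n := by rw [hn]; exact_mod_cast Fintype.card_pos
  have hN0 : 0 ≤ N := Nat.cast_nonneg _
  have hNn : N ≤ n := by rw [hN, hn]; exact_mod_cast Finset.card_le_univ _
  -- Each vertex contributes at most the terms that enter `drift_inequality`.
  have hterm : ∀ u, (h u * (1 - x u) - (G.maxDegree : ℝ) * l u) * marginal G c u ≤
      (h u - x u * h u) - (1 - x u) * h u ^ 2 / (4 * q) - (q - 1) * l u +
        (q * x u - x u * d u) / 8 + x u * h u / 4 := by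
    intro u
    have hm : marginal G c u = 1 - (q - d u) / (8 * q) - h u / (4 * q) := by
      change 7 / 8 + (d u - 2 * h u) / (8 * q) = _
      field_simp; ring
    have hmd : (G.maxDegree : ℝ) = q - 1 := by rw [hq]; ring
    have a1 : 0 ≤ (q - d u) / (8 * q) := div_nonneg (by linarith [hdq u]) (by positivity)
    have b1 : h u * (1 - x u) * marginal G c u ≤
        (h u - x u * h u) - (1 - x u) * h u ^ 2 / (4 * q) := by
      rw [hm]
      have := mul_nonneg (mul_nonneg (hh0 u) (sub_nonneg.2 (hx1 u))) a1
      have e : (1 - x u) * h u ^ 2 / (4 * q) = h u * (1 - x u) * (h u / (4 * q)) := by ring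
      rw [e]
      nlinarith
    have b2 : -((q - 1) * l u * marginal G c u) ≤
        -((q - 1) * l u) + ((q * x u - x u * d u) / 8 + x u * h u / 4) := by
      have z0 : 0 ≤ (q - d u) / 8 + h u / 4 := by linarith [hdq u, hh0 u]
      have e : -((q - 1) * l u * marginal G c u) =
          -((q - 1) * l u) + l u * ((q - 1) / q) * ((q - d u) / 8 + h u / 4) := by
        rw [hm]; field_simp; ring
      have z1 : l u * ((q - 1) / q) ≤ x u := by
        refine le_trans (mul_le_of_le_one_right (hl0 u) ?_) (hlx u)
        rw [div_le_one hq0]; linarith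
      have := mul_le_mul_of_nonneg_right z1 z0
      rw [e]
      linarith
    rw [hmd]
    linarith
  have hsum := Finset.sum_le_sum fun u (_ : u ∈ Finset.univ) => hterm u
  have hsh : ∑ u, h u = ∑ u, x u * d u := by
    have := sum_adjMatrix_symm G (fun _ => 1) x
    simpa only [one_mul, mul_one] using this
  simp only [Finset.sum_add_distrib, Finset.sum_sub_distrib, ← Finset.sum_div, ← Finset.mul_sum,
    hsh, hsx] at hsum
  have hLN : ∑ u, l u ≤ N := hsx ▸ Finset.sum_le_sum fun u _ => hlx u
  have hCS : (∑ u, x u * d u - ∑ u, x u * h u) ^ 2 ≤ n * ∑ u, (1 - x u) * h u ^ 2 := by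
    have e : ∑ u, x u * d u - ∑ u, x u * h u = ∑ u, (1 - x u) * h u := by
      rw [← hsh, ← Finset.sum_sub_distrib]
      exact Finset.sum_congr rfl fun u _ => by ring
    rw [e]
    refine sq_sum_le_card_mul_sum_sq.trans ?_
    rw [Finset.card_univ]
    refine mul_le_mul_of_nonneg_left (Finset.sum_le_sum fun u _ => ?_) hn0.le
    rw [mul_pow]
    refine mul_le_mul_of_nonneg_right ?_ (sq_nonneg _)
    nlinarith [hx0 u, hx1 u]
  have hfin := drift_inequality (M := ∑ u, monoDegree G c u) hq1 hN0 hNn hn0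
    (D := ∑ u, x u * d u) (H := ∑ u, x u * h u) (L := ∑ u, l u)
    (by rw [← hsx, Finset.mul_sum]
        exact Finset.sum_le_sum fun u _ => by
          rw [mul_comm]; exact mul_le_mul_of_nonneg_right (hdq u) (hx0 u))
    (Finset.sum_nonneg fun u _ => mul_nonneg (hx0 u) (hh0 u)) hLN
    (Finset.sum_nonneg fun u _ => hl0 u)
    (by rw [← hsx, Finset.mul_sum, ← Finset.sum_add_distrib]
        exact Finset.sum_le_sum fun u _ => two_mul_conflictIndicator_le G c u) hCS
  have hpot : potential G c ≤ (∑ u, monoDegree G c u) / 2 + N := potential_le G c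
  have hpot' := mul_le_mul_of_nonneg_left hpot (by positivity : 0 ≤ q * N / (8 * n))
  have e1 : q * N * ((1 - 1 / (8 * n)) * potential G c) =
      q * (N * potential G c) - q * N / (8 * n) * potential G c := by ring
  have e2 : -(q * N * ((∑ u, monoDegree G c u) / 2 + N)) / (8 * n) =
      -(q * N / (8 * n) * ((∑ u, monoDegree G c u) / 2 + N)) := by ring
  rw [e1]
  rw [e2] at hfin
  linarith

/-! ### The random process -/

theorem integral_step (f : Assignment G → ℝ) (c : Assignment G) (h : (conflicted G c).Nonempty) :
    ∫ c', f c' ∂(step G c).toMeasure =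
      (((G.maxDegree : ℝ) + 1) * (conflicted G c).card)⁻¹ *
        ∑ v ∈ conflicted G c, ∑ b, f (Function.update c v b) := by
  have key : ∀ c', (step G c c').toReal = (((G.maxDegree : ℝ) + 1) * (conflicted G c).card)⁻¹ *
      ∑ v ∈ conflicted G c, ∑ b, if c' = Function.update c v b then 1 else 0 := by
    intro c'
    rw [step, dif_pos h, PMF.bind_apply, tsum_fintype, ENNReal.toReal_sum fun v _ => by
      exact ENNReal.mul_ne_top (PMF.apply_ne_top _ _) (PMF.apply_ne_top _ _)]
    simp only [ENNReal.toReal_mul, PMF.uniformOfFinset_apply, PMF.map_apply, tsum_fintype,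
      PMF.uniformOfFintype_apply, Fintype.card_fin]
    rw [Finset.mul_sum, ← Finset.sum_subset (Finset.subset_univ (conflicted G c))]
    · refine Finset.sum_congr rfl fun v hv => ?_
      rw [if_pos hv, ENNReal.toReal_sum fun b _ => by split_ifs <;> simp, Finset.mul_sum,
        Finset.mul_sum]
      refine Finset.sum_congr rfl fun b _ => ?_
      split_ifs
      · simp [ENNReal.toReal_inv, ENNReal.toReal_add]
      · simp
    · intro v _ hv
      rw [if_neg hv]; simp
  rw [PMF.integral_eq_sum]
  simp only [key, smul_eq_mul]
  simp only [mul_assoc, ← Finset.mul_sum, Finset.sum_mul]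
  congr 1
  rw [Finset.sum_comm]
  refine Finset.sum_congr rfl fun v _ => ?_
  rw [Finset.sum_comm]
  simp

theorem integral_step_of_not_nonempty (f : Assignment G → ℝ) (c : Assignment G)
    (h : ¬ (conflicted G c).Nonempty) : ∫ c', f c' ∂(step G c).toMeasure = f c := by
  rw [step, dif_neg h, PMF.toMeasure_pure, integral_dirac]

theorem potential_eq_zero {c : Assignment G} (h : ¬ (conflicted G c).Nonempty) :
    potential G c = 0 := by
  rw [Finset.not_nonempty_iff_eq_empty] at h
  have h1 : ∀ u, conflictIndicator G c u = 0 := fun u => by simp [conflictIndicator, h]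
  have h2 : ∀ u, monoDegree G c u = 0 := fun u =>
    monoDegree_eq_zero_of_notMem G (by simp [h])
  simp [potential, energy, h1, h2]

theorem integral_step_potential_le [Nonempty V] (c : Assignment G) :
    ∫ c', potential G c' ∂(step G c).toMeasure ≤
      (1 - 1 / (8 * Fintype.card V)) * potential G c := by
  by_cases h : (conflicted G c).Nonempty
  · rw [integral_step G _ c h, inv_mul_le_iff₀]
    · exact potential_drift G c
    · have : (0 : ℝ) < (conflicted G c).card := by exact_mod_cast h.card_pos
      positivity
  · rw [integral_step_of_not_nonempty G _ c h, potential_eq_zero G h, mul_zero]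

/-- The Markov property, for the expectation of a function of the current coloring. -/
theorem integral_processLaw_succ (f : Assignment G → ℝ) (t : ℕ) :
    ∫ ω, f (ω (t + 1)) ∂(processLaw G) =
      ∫ ω, ∫ c', f c' ∂(step G (ω t)).toMeasure ∂(processLaw G) := by
  have h := Kernel.map_frestrictLe_trajMeasure_compProd_eq_map_trajMeasure
    (X := fun _ : ℕ => Assignment G) (μ₀ := initialLaw G) (κ := stepKernel G) (a := t)
  have hf : Measurable f := measurable_of_finite f
  have e1 : ∫ ω, f (ω (t + 1)) ∂(processLaw G) =
      ∫ z, f z.2 ∂((processLaw G).map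
        (fun x => (Preorder.frestrictLe t x, x (t + 1)))) := by
    rw [integral_map (by fun_prop) (by fun_prop)]
  rw [e1, processLaw, ← h, Measure.integral_compProd .of_finite,
    integral_map (by fun_prop) (measurable_of_finite _).aestronglyMeasurable]
  rfl

theorem integral_potential_le [Nonempty V] (t : ℕ) :
    ∫ ω, potential G (ω t) ∂(processLaw G) ≤
      (1 - 1 / (8 * Fintype.card V)) ^ t * (2 * (Fintype.card V : ℝ) ^ 2) := by
  have hn : (1 : ℝ) ≤ Fintype.card V := by exact_mod_cast Fintype.card_pos (α := V)
  have hr : (0 : ℝ) ≤ 1 - 1 / (8 * Fintype.card V) := by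
    rw [sub_nonneg, div_le_one (by positivity)]; linarith
  have hint : ∀ (f : Assignment G → ℝ) (t : ℕ),
      Integrable (fun ω => f (ω t)) (processLaw G) := fun f t => by
    have : Integrable f ((processLaw G).map (fun ω => ω t)) := .of_finite
    exact this.comp_measurable (by fun_prop)
  induction t with
  | zero =>
    rw [pow_zero, one_mul]
    refine (integral_mono (hint (potential G) 0) (integrable_const (2 * (Fintype.card V : ℝ) ^ 2))
      fun ω => potential_le_sq G (ω 0)).trans ?_
    simp
  | succ t ih =>
    rw [integral_processLaw_succ, pow_succ', mul_assoc]
    refine (integral_mono (hint (fun c => ∫ c', potential G c' ∂(step G c).toMeasure) t)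
      ((hint (potential G) t).const_mul _) fun ω => integral_step_potential_le G (ω t)).trans ?_
    rw [integral_const_mul]
    exact mul_le_mul_of_nonneg_left ih hr

theorem measureReal_not_isProper_le [Nonempty V] (t : ℕ) :
    (processLaw G).real {ω | ¬ IsProper G (ω t)} ≤
      4 * (Fintype.card V : ℝ) ^ 2 * Real.exp (-(t / (8 * Fintype.card V))) := by
  have hn : (1 : ℝ) ≤ Fintype.card V := by exact_mod_cast Fintype.card_pos (α := V)
  have hpos : ∀ c, 0 ≤ potential G c := fun c =>
    le_trans (by positivity) (card_le_potential G c)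
  have hint : Integrable (fun ω => potential G (ω t)) (processLaw G) := by
    have : Integrable (potential G) ((processLaw G).map (fun ω => ω t)) := .of_finite
    exact this.comp_measurable (by fun_prop)
  have hM := mul_meas_ge_le_integral_of_nonneg (μ := processLaw G)
    (f := fun ω => potential G (ω t)) (Filter.Eventually.of_forall fun ω => hpos _) hint (7 / 8)
  have hsub : (processLaw G).real {ω | ¬ IsProper G (ω t)} ≤
      (processLaw G).real {ω | 7 / 8 ≤ potential G (ω t)} := by
    refine measureReal_mono fun ω hω => ?_
    have h1 := (conflicted_nonempty_iff G (ω t)).2 hω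
    have h2 : (1 : ℝ) ≤ (conflicted G (ω t)).card := by exact_mod_cast h1.card_pos
    have := card_le_potential G (ω t)
    change 7 / 8 ≤ potential G (ω t)
    linarith
  have hexp : (1 - 1 / (8 * (Fintype.card V : ℝ))) ^ t ≤
      Real.exp (-(t / (8 * Fintype.card V))) := by
    have h0 : 0 ≤ 1 - 1 / (8 * (Fintype.card V : ℝ)) := by
      rw [sub_nonneg, div_le_one (by positivity)]; linarith
    have := pow_le_pow_left₀ h0 (Real.one_sub_le_exp_neg (1 / (8 * (Fintype.card V : ℝ)))) t
    refine this.trans_eq ?_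
    rw [← Real.exp_nat_mul]
    congr 1; ring
  have h3 := integral_potential_le G t
  have h4 := mul_le_mul_of_nonneg_right hexp (by positivity : 0 ≤ 2 * (Fintype.card V : ℝ) ^ 2)
  have h5 : 0 ≤ (processLaw G).real {ω | 7 / 8 ≤ potential G (ω t)} := measureReal_nonneg
  linarith

theorem not_isProper_of_lt_runtime {ω : ℕ → Assignment G} {t : ℕ} (h : (t : ℕ∞) < runtime G ω) :
    ¬ IsProper G (ω t) := fun hp =>
  absurd (iInf₂_le t hp) (not_le.2 h)

end

end DecentralizedColoring

theorem mainTheorem4 (c : ℝ) (hc : 0 < c) :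
    ∃ C : ℝ, 0 < C ∧ ∀ a : ℝ, 0 < a → ∃ K : ℝ, 0 < K ∧
      ∀ (V : Type*) [Fintype V] [DecidableEq V] [Nonempty V]
        (G : SimpleGraph V) [DecidableRel G.Adj],
        a * (Fintype.card V : ℝ) ^ c ≤ (G.maxDegree : ℝ) →
          (DecentralizedColoring.processLaw G).real
              {ω | ENNReal.ofReal (C * Fintype.card V * Real.log G.maxDegree) <
                (DecentralizedColoring.runtime G ω : ENNReal)} ≤
            K * (Fintype.card V : ℝ) ^ (-c) := by
  -- `C` turns the failure bound `n ^ 2 * Δ ^ (-C / 8)` into a multiple of `n ^ (-c)`.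
  refine ⟨8 * ((2 + c) / c), by positivity, fun a ha =>
    ⟨4 * Real.exp 1 * a ^ (-((2 + c) / c)), by positivity, ?_⟩⟩
  intro V _ _ _ G _ hΔ
  set n : ℝ := (Fintype.card V : ℝ) with hn
  set s : ℝ := (2 + c) / c with hs
  have hs0 : 0 < s := by positivity
  have hn1 : 1 ≤ n := by rw [hn]; exact_mod_cast Fintype.card_pos (α := V)
  have hn0 : 0 < n := by linarith
  have hnc : 0 < n ^ c := Real.rpow_pos_of_pos hn0 c
  have hΔ0 : (0 : ℝ) < G.maxDegree := lt_of_lt_of_le (by positivity) hΔ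
  have hΔ1 : (1 : ℝ) ≤ G.maxDegree := by exact_mod_cast Nat.cast_pos.1 hΔ0
  set x : ℝ := 8 * s * n * Real.log G.maxDegree with hx
  have hx0 : 0 ≤ x := by
    have := Real.log_nonneg hΔ1
    positivity
  -- The runtime is an integer, so it exceeds `x` only if it exceeds `⌊x⌋`.
  have hsub : {ω | ENNReal.ofReal x < (DecentralizedColoring.runtime G ω : ENNReal)} ⊆
      {ω | ¬ DecentralizedColoring.IsProper G (ω ⌊x⌋₊)} := by
    intro ω hω
    refine DecentralizedColoring.not_isProper_of_lt_runtime G ?_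
    have h1 : ((⌊x⌋₊ : ℕ) : ENNReal) ≤ ENNReal.ofReal x := by
      rw [← ENNReal.ofReal_natCast]
      exact ENNReal.ofReal_le_ofReal (Nat.floor_le hx0)
    have h2 := lt_of_le_of_lt h1 hω
    exact_mod_cast h2
  refine (MeasureTheory.measureReal_mono hsub).trans
    ((DecentralizedColoring.measureReal_not_isProper_le G ⌊x⌋₊).trans ?_)
  rw [← hn]
  have hfloor : x - 1 ≤ (⌊x⌋₊ : ℝ) := (Nat.sub_one_lt_floor x).le
  have hexp : Real.exp (-((⌊x⌋₊ : ℝ) / (8 * n))) ≤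
      Real.exp 1 * (a ^ (-s) * n ^ (-(2 + c))) := by
    have e1 : -((⌊x⌋₊ : ℝ) / (8 * n)) ≤ 1 + Real.log G.maxDegree * (-s) := by
      have e2 : x / (8 * n) = Real.log G.maxDegree * s := by rw [hx]; field_simp
      have e3 := div_le_div_of_nonneg_right hfloor (by positivity : 0 ≤ 8 * n)
      have e4 : 1 / (8 * n) ≤ 1 := by rw [div_le_one (by positivity)]; linarith
      rw [sub_div, e2] at e3
      linarith
    have e5 : (a * n ^ c) ^ (-s) = a ^ (-s) * n ^ (-(2 + c)) := by
      rw [Real.mul_rpow ha.le hnc.le, ← Real.rpow_mul hn0.le]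
      congr 2
      rw [hs]; field_simp
    rw [← e5]
    refine (Real.exp_le_exp.2 e1).trans ?_
    rw [Real.exp_add, ← Real.rpow_def_of_pos hΔ0]
    exact mul_le_mul_of_nonneg_left
      (Real.rpow_le_rpow_of_nonpos (by positivity) hΔ (by linarith)) (Real.exp_pos _).le
  refine (mul_le_mul_of_nonneg_left hexp (by positivity)).trans_eq ?_
  have : n ^ (-c) = n ^ 2 * n ^ (-(2 + c)) := by
    rw [← Real.rpow_natCast n 2, ← Real.rpow_add hn0]
    congr 1; push_cast; ring
  rw [this]
  ring
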